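/- Let $X$ be a Tychonoff space with Stone–Čech compactification $\beta X$ and (Hewitt) realcompactification $\upsilon X\subseteq\beta X$, the subspace of those points of $\beta X$ at which the continuous extension $\beta X\to\mathbb R\cup\{\infty\}$ of every continuous function $X\to\mathbb R$ is finite. All compact and locally compact spaces are assumed Hausdorff. For a Tychonoff space $Y$, let $C_p(Y)$ be the space of all continuous real-valued functions on $Y$ with the topology of pointwise convergence, and let $C_p^b(Y)$ be its subspace of bounded functions. A Tychonoff space is called a $\kappa$-space if it is homeomorphic to a closed subspace of $C_p(Y)$ for some locally compact space $Y$; the $\kappa$-completion $\kappa X$ of $X$ is the intersection of all subspaces of $\beta X$ that contain $X$ and are $\kappa$-spaces. For $z\in\upsilon X$ and $f\in C_p(X)$ put $\delta_z(f):=\bar f(z)$, where $\bar f$ is the unique continuous extension of $f$ to $\upsilon X$. A real-valued function on a topological space is called $k$-continuous if its restriction to every compact subset is continuous. A set $A\subseteq C_p(X)$ is uniformly bounded if there is $C>0$ such that $|f(x)|\le C$ for all $f\in A$ and $x\in X$. Let $z\in\beta X$. Then the following assertions are equivalent: (i) $z\in\kappa X$; (ii) for each compact space $K$, every continuous map $\varphi:X\to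 C_p(K)$ extends to a continuous map $\hat\varphi:X\cup\{z\}\to C_p(K)$, where $X\cup\{z\}$ carries the subspace topology from $\beta X$; (iii) $z\in\upsilon X$ and $\delta_z$ is $k$-continuous on $C_p(X)$; (iv) $z\in\upsilon X$ and the restriction of $\delta_z$ to $C_p^b(X)$ is $k$-continuous; (v) $z\in\upsilon X$ and, for every uniformly bounded compact subset $A$ of $C_p(X)$, the restriction of $\delta_z$ to $A$ is $k$-continuous. -/

import Mathlib

universe u

/-- `C_p(X)`: the continuous real-valued functions on `X` with the topology of pointwise
convergence, i.e. the subspace topology inherited from the product `ℝ^X`. -/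
abbrev Cp (X : Type u) [TopologicalSpace X] : Type u :=
  {f : X → ℝ // Continuous f}

/-- `C_p^b(X)`: the subspace of `C_p(X)` consisting of the bounded functions. -/
abbrev CpBounded (X : Type u) [TopologicalSpace X] : Type u :=
  {f : Cp X // ∃ C : ℝ, ∀ x : X, |f.1 x| ≤ C}

/-- A set `A` of continuous functions is uniformly bounded if one constant bounds all of them. -/
def UniformlyBounded {X : Type u} [TopologicalSpace X] (A : Set (Cp X)) : Prop :=
  ∃ C : ℝ, 0 < C ∧ ∀ f ∈ A, ∀ x : X, |f.1 x| ≤ C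

/-- A real function is `k`-continuous if its restriction to every compact set is continuous. -/
def KContinuous {Y : Type u} [TopologicalSpace Y] (f : Y → ℝ) : Prop :=
  ∀ K : Set Y, IsCompact K → ContinuousOn f K

/-- A Tychonoff space `X` is a `κ`-space if it is homeomorphic to a closed subspace of `C_p(Y)`
for some locally compact (Hausdorff) space `Y`. -/
def IsKappaSpace (X : Type u) [TopologicalSpace X] : Prop :=
  T35Space X ∧ ∃ (Y : Type u) (_ : TopologicalSpace Y), T2Space Y ∧ LocallyCompactSpace Y ∧
    ∃ e : X → Cp Y, Topology.IsClosedEmbedding e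

/-- The `κ`-completion of `X`: the intersection of all subspaces of `βX` that contain `X`
and are `κ`-spaces. -/
def kappaCompletion (X : Type u) [TopologicalSpace X] : Set (StoneCech X) :=
  ⋂₀ {S : Set (StoneCech X) | Set.range (stoneCechUnit : X → StoneCech X) ⊆ S ∧ IsKappaSpace S}

/-- The continuous extension `βX → ℝ ∪ {∞}` of a continuous function `X → ℝ`. -/
noncomputable def stoneCechExtendReal {X : Type u} [TopologicalSpace X] (f : Cp X) :
    StoneCech X → OnePoint ℝ :=
  stoneCechExtend (g := fun x : X => (f.1 x : OnePoint ℝ))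
    (OnePoint.continuous_coe.comp f.2)

/-- The (Hewitt) realcompactification `υX`, as a subspace of `βX`: the points at which
the extension `βX → ℝ ∪ {∞}` of every continuous function `X → ℝ` is finite. -/
def realcompactification (X : Type u) [TopologicalSpace X] : Set (StoneCech X) :=
  {z | ∀ f : Cp X, stoneCechExtendReal f z ≠ OnePoint.infty}

/-- The extension of a continuous function `f : X → ℝ` to `υX`. -/
noncomputable def realcompactExtend {X : Type u} [TopologicalSpace X] (f : Cp X)
    (z : realcompactification X) : ℝ :=
  Classical.choose (OnePoint.ne_infty_iff_exists.mp (z.2 f))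

theorem coe_realcompactExtend {X : Type u} [TopologicalSpace X] (f : Cp X)
    (z : realcompactification X) :
    (realcompactExtend f z : OnePoint ℝ) = stoneCechExtendReal f z.1 :=
  Classical.choose_spec (OnePoint.ne_infty_iff_exists.mp (z.2 f))

/-- The extension of `f` to `υX` is continuous. -/
theorem continuous_realcompactExtend {X : Type u} [TopologicalSpace X] (f : Cp X) :
    Continuous (realcompactExtend f) := by
  rw [OnePoint.isOpenEmbedding_coe.isEmbedding.continuous_iff]
  have h : ((fun r : ℝ => (r : OnePoint ℝ)) ∘ realcompactExtend f)
      = fun z : realcompactification X => stoneCechExtendReal f z.1 :=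
    funext fun z => coe_realcompactExtend f z
  rw [h]
  exact (continuous_stoneCechExtend _).comp continuous_subtype_val

/-- `X ⊆ υX`. -/
theorem stoneCechUnit_mem_realcompactification {X : Type u} [TopologicalSpace X] (x : X) :
    stoneCechUnit x ∈ realcompactification X := by
  intro f
  have h : stoneCechExtendReal f (stoneCechUnit x) = (f.1 x : OnePoint ℝ) :=
    stoneCechExtend_stoneCechUnit _ x
  rw [h]
  exact OnePoint.coe_ne_infty _

/-- The extension of `f` to `υX` agrees with `f` on `X`. -/
theorem realcompactExtend_stoneCechUnit {X : Type u} [TopologicalSpace X] (f : Cp X) (x : X) :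
    realcompactExtend f ⟨stoneCechUnit x, stoneCechUnit_mem_realcompactification x⟩ = f.1 x := by
  have h : stoneCechExtendReal f (stoneCechUnit x) = (f.1 x : OnePoint ℝ) :=
    stoneCechExtend_stoneCechUnit _ x
  exact OnePoint.coe_injective ((coe_realcompactExtend f _).trans h)

/-- The Dirac measure `δ_z` at `z ∈ υX`, as a functional on `C_p(X)`: it sends `f` to the value
at `z` of the extension of `f` to `υX`. -/
noncomputable def diracAt {X : Type u} [TopologicalSpace X] (z : realcompactification X) :
    Cp X → ℝ :=
  fun f => realcompactExtend f z

/-- The subspace `X ∪ {z}` of `βX`. -/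
abbrev addPoint {X : Type u} [TopologicalSpace X] (z : StoneCech X) : Set (StoneCech X) :=
  Set.range (stoneCechUnit : X → StoneCech X) ∪ {z}

/-- The inclusion of `X` into `X ∪ {z}`. -/
def toAddPoint {X : Type u} [TopologicalSpace X] (z : StoneCech X) (x : X) : addPoint z :=
  ⟨stoneCechUnit x, Or.inl ⟨x, rfl⟩⟩

open Topology Filter Set

section

variable {X : Type u} [TopologicalSpace X]

/-! Exchanging arguments turns a continuous `φ : X → C_p(Y)` into a continuous map `Y → C_p(X)`.
Composing the latter with `δ_z` gives the only possible value of an extension of `φ` at `z`, and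
this value is continuous on locally compact `Y` when `δ_z` is `k`-continuous. Conversely, evaluation
`X → C_p(A)` for compact `A ⊆ C_p(X)` tests `k`-continuity on `A`. For `κX`, the points with
`k`-continuous `δ_z` themselves form a `κ`-space (`isKappaSpace_kContinuousPoints`), and every
`κ`-space between `X` and `βX` contains them. Composing with `arctan` reduces compact sets to
uniformly bounded ones. -/

theorem denseRange_stoneCechUnit_codRestrict {S : Set (StoneCech X)}
    (h : ∀ x : X, stoneCechUnit x ∈ S) :
    DenseRange (fun x : X => (⟨stoneCechUnit x, h x⟩ : S)) := by
  intro y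
  rw [closure_subtype, ← range_comp]
  exact denseRange_stoneCechUnit y.1

theorem continuous_stoneCechExtendReal (f : Cp X) : Continuous (stoneCechExtendReal f) :=
  continuous_stoneCechExtend _

theorem stoneCechExtendReal_stoneCechUnit (f : Cp X) (x : X) :
    stoneCechExtendReal f (stoneCechUnit x) = (f.1 x : OnePoint ℝ) :=
  stoneCechExtend_stoneCechUnit _ x

/-- A continuous real extension of `f` to a subspace of `βX` containing `X` agrees with the
extension of `f` to `βX`. -/
theorem stoneCechExtendReal_eq_coe {S : Set (StoneCech X)} (h : ∀ x : X, stoneCechUnit x ∈ S)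
    (f : Cp X) {g : S → ℝ} (hg : Continuous g) (hgf : ∀ x, g ⟨stoneCechUnit x, h x⟩ = f.1 x)
    (y : S) : stoneCechExtendReal f y.1 = (g y : OnePoint ℝ) := by
  refine congrFun ((denseRange_stoneCechUnit_codRestrict h).equalizer
    ((continuous_stoneCechExtendReal f).comp continuous_subtype_val)
    (OnePoint.continuous_coe.comp hg) (funext fun x => ?_)) y
  simp only [Function.comp_apply, hgf, stoneCechExtendReal_stoneCechUnit]

theorem realcompactExtend_eq {f : Cp X} {z : realcompactification X} {r : ℝ}
    (h : stoneCechExtendReal f z.1 = (r : OnePoint ℝ)) : realcompactExtend f z = r :=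
  OnePoint.coe_injective ((coe_realcompactExtend f z).trans h)

theorem realcompactExtend_comp (h : ℝ → ℝ) (hh : Continuous h) (f : Cp X)
    (z : realcompactification X) :
    realcompactExtend (⟨h ∘ f.1, hh.comp f.2⟩ : Cp X) z = h (realcompactExtend f z) :=
  realcompactExtend_eq <| stoneCechExtendReal_eq_coe stoneCechUnit_mem_realcompactification
    ⟨h ∘ f.1, hh.comp f.2⟩ (hh.comp (continuous_realcompactExtend f))
    (fun x => congrArg h (realcompactExtend_stoneCechUnit f x)) z

theorem continuous_eval_Cp (x : X) : Continuous (fun f : Cp X => f.1 x) :=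
  (continuous_apply x).comp continuous_subtype_val

theorem continuous_Cp_iff {Y : Type*} [TopologicalSpace Y] {φ : Y → Cp X} :
    Continuous φ ↔ ∀ x, Continuous (fun y => (φ y).1 x) :=
  continuous_induced_rng.trans continuous_pi_iff

/-- The map `Y → C_p(X)` obtained from `φ : X → C_p(Y)` by exchanging the two arguments. -/
def Cp.swap {Y : Type u} [TopologicalSpace Y] (φ : X → Cp Y) (hφ : Continuous φ) (y : Y) : Cp X :=
  ⟨fun x => (φ x).1 y, (continuous_eval_Cp y).comp hφ⟩

theorem Cp.continuous_swap {Y : Type u} [TopologicalSpace Y] (φ : X → Cp Y)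
    (hφ : Continuous φ) : Continuous (Cp.swap φ hφ) :=
  continuous_Cp_iff.2 fun x => (φ x).2

theorem KContinuous.continuous_comp {Y Z : Type u} [TopologicalSpace Y] [TopologicalSpace Z]
    [LocallyCompactSpace Y] {f : Z → ℝ} (hf : KContinuous f) {g : Y → Z} (hg : Continuous g) :
    Continuous (f ∘ g) := by
  refine continuous_iff_continuousAt.2 fun y => ?_
  obtain ⟨K, hK, hy⟩ := exists_compact_mem_nhds y
  exact ((hf _ (hK.image hg)).comp hg.continuousOn (mapsTo_image g K)).continuousAt hy

theorem KContinuous.comp {Y Z : Type u} [TopologicalSpace Y] [TopologicalSpace Z] {f : Z → ℝ}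
    (hf : KContinuous f) {g : Y → Z} (hg : Continuous g) : KContinuous (f ∘ g) :=
  fun K hK => (hf _ (hK.image hg)).comp hg.continuousOn (mapsTo_image g K)

theorem addPoint_subset_realcompactification {z : StoneCech X}
    (hz : z ∈ realcompactification X) : addPoint z ⊆ realcompactification X := by
  rintro _ (⟨x, rfl⟩ | rfl)
  exacts [stoneCechUnit_mem_realcompactification x, hz]

/-- If `δ_z` is `k`-continuous, then every continuous map from `X` into `C_p(Y)` with `Y` locally
compact extends continuously to `X ∪ {z}`. -/
theorem exists_continuous_extension_addPoint {z : StoneCech X} (hz : z ∈ realcompactification X)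
    (hk : KContinuous (diracAt ⟨z, hz⟩)) {Y : Type u} [TopologicalSpace Y]
    [LocallyCompactSpace Y] (φ : X → Cp Y) (hφ : Continuous φ) :
    ∃ ψ : addPoint z → Cp Y, Continuous ψ ∧ ∀ x : X, ψ (toAddPoint z x) = φ x := by
  let i := inclusion (addPoint_subset_realcompactification hz)
  have hx : ∀ (x : X) (y : Y), realcompactExtend (Cp.swap φ hφ y) (i (toAddPoint z x))
      = (φ x).1 y := fun x y => realcompactExtend_stoneCechUnit (Cp.swap φ hφ y) x
  have hc : ∀ w : addPoint z,
      Continuous (fun y => realcompactExtend (Cp.swap φ hφ y) (i w)) := by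
    rintro ⟨_, ⟨x, rfl⟩ | rfl⟩
    · exact (φ x).2.congr fun y => (hx x y).symm
    · exact hk.continuous_comp (Cp.continuous_swap φ hφ)
  refine ⟨fun w => ⟨_, hc w⟩, continuous_Cp_iff.2 fun y => ?_, fun x => ?_⟩
  · exact (continuous_realcompactExtend _).comp (continuous_inclusion _)
  · exact Subtype.ext (funext (hx x))

theorem mem_kappaCompletion_of_kContinuous {z : StoneCech X} (hz : z ∈ realcompactification X)
    (hk : KContinuous (diracAt ⟨z, hz⟩)) : z ∈ kappaCompletion X := by
  rintro S ⟨hXS, -, Y, _, _, _, e, he⟩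
  let j : X → S := fun x => ⟨stoneCechUnit x, hXS ⟨x, rfl⟩⟩
  have hj : Continuous j := continuous_stoneCechUnit.subtype_mk _
  obtain ⟨ψ, hψ, hψx⟩ :=
    exists_continuous_extension_addPoint hz hk (e ∘ j) (he.continuous.comp hj)
  have hd : DenseRange (toAddPoint z) :=
    denseRange_stoneCechUnit_codRestrict fun x => Or.inl ⟨x, rfl⟩
  -- Closedness of `range e` keeps the extension inside the copy of `S`; the induced map into `S`
  -- fixes the dense set `X`, hence also `z`.
  have hrange : ∀ w, ψ w ∈ range e := fun w =>
    hd.induction_on w (he.isClosed_range.preimage hψ) fun x => hψx x ▸ mem_range_self (j x)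
  choose t ht using hrange
  have htc : Continuous t := by
    rw [he.isInducing.continuous_iff]
    exact hψ.congr fun w => (ht w).symm
  have hval : Subtype.val ∘ t = Subtype.val :=
    hd.equalizer (continuous_subtype_val.comp htc) continuous_subtype_val <| funext fun x =>
      congrArg Subtype.val (he.injective ((ht _).trans (hψx x)) : t (toAddPoint z x) = j x)
  have hzz : (t ⟨z, Or.inr rfl⟩ : StoneCech X) = z := congrFun hval ⟨z, Or.inr rfl⟩
  exact hzz ▸ (t _).2

theorem exists_kContinuous_of_extension {z : StoneCech X}
    (h : ∀ (K : Type u) [TopologicalSpace K] [CompactSpace K] [T2Space K] (φ : X → Cp K),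
      Continuous φ →
        ∃ ψ : addPoint z → Cp K, Continuous ψ ∧ ∀ x : X, ψ (toAddPoint z x) = φ x) :
    ∃ hz : z ∈ realcompactification X, KContinuous (diracAt ⟨z, hz⟩) := by
  have key : ∀ A : Set (Cp X), IsCompact A → ∃ g : Cp A,
      ∀ f : A, stoneCechExtendReal f.1 z = (g.1 f : OnePoint ℝ) := by
    intro A hA
    have : CompactSpace A := isCompact_iff_compactSpace.1 hA
    obtain ⟨ψ, hψ, hψx⟩ := h A
      (fun x => ⟨fun f => f.1.1 x, (continuous_eval_Cp x).comp continuous_subtype_val⟩)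
      (continuous_Cp_iff.2 fun f => f.1.2)
    refine ⟨ψ ⟨z, Or.inr rfl⟩, fun f => ?_⟩
    exact stoneCechExtendReal_eq_coe (S := addPoint z) (fun x => Or.inl ⟨x, rfl⟩) f.1
      ((continuous_eval_Cp f).comp hψ) (fun x => congrArg (fun g => g.1 f) (hψx x))
      ⟨z, Or.inr rfl⟩
  have hz : z ∈ realcompactification X := by
    intro f
    -- Singletons are compact, so they already force finiteness at `z`.
    obtain ⟨g, hg⟩ := key {f} isCompact_singleton
    rw [hg ⟨f, rfl⟩]
    exact OnePoint.coe_ne_infty _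
  refine ⟨hz, fun A hA => ?_⟩
  obtain ⟨g, hg⟩ := key A hA
  rw [continuousOn_iff_continuous_domRestrict]
  exact g.2.congr fun f => (realcompactExtend_eq (z := ⟨z, hz⟩) (hg f)).symm

/-- The points `z` of `βX` lying in `υX` for which `δ_z` is `k`-continuous. -/
def kContinuousPoints (X : Type u) [TopologicalSpace X] : Set (StoneCech X) :=
  {z | ∃ hz : z ∈ realcompactification X, KContinuous (diracAt ⟨z, hz⟩)}

theorem stoneCechUnit_mem_kContinuousPoints (x : X) :
    stoneCechUnit x ∈ kContinuousPoints X := by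
  refine ⟨stoneCechUnit_mem_realcompactification x, fun A _ => Continuous.continuousOn ?_⟩
  exact (continuous_eval_Cp x).congr fun f => (realcompactExtend_stoneCechUnit f x).symm

/-- The locally compact space is the disjoint sum of all compact subsets of `C_p(X)`: continuity of
`δ_z` on the sum is exactly `k`-continuity. Closedness comes from compactness of `βX`. -/
theorem isKappaSpace_kContinuousPoints : IsKappaSpace (kContinuousPoints X) := by
  refine ⟨inferInstance, Σ K : {K : Set (Cp X) // IsCompact K}, K.1, inferInstance,
    inferInstance, ?_, ?_⟩
  · have : ∀ K : {K : Set (Cp X) // IsCompact K}, CompactSpace K.1 :=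
      fun K => isCompact_iff_compactSpace.1 K.2
    have : WeaklyLocallyCompactSpace (Σ K : {K : Set (Cp X) // IsCompact K}, K.1) :=
      ⟨fun p => ⟨range (Sigma.mk p.1), isCompact_range continuous_sigmaMk,
        isOpen_range_sigmaMk.mem_nhds ⟨p.2, rfl⟩⟩⟩
    infer_instance
  let e : kContinuousPoints X → Cp (Σ K : {K : Set (Cp X) // IsCompact K}, K.1) := fun z =>
    ⟨fun p => diracAt ⟨z.1, z.2.1⟩ p.2.1,
      continuous_sigma fun K => continuousOn_iff_continuous_domRestrict.1 (z.2.2 K.1 K.2)⟩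
  have he : Continuous e := continuous_Cp_iff.2 fun p =>
    (continuous_realcompactExtend p.2.1).comp
      (continuous_inclusion (s := kContinuousPoints X) fun z hz => hz.1)
  have hinj : Function.Injective e := by
    intro z w hzw
    refine Subtype.ext ?_
    have hf : ∀ f : Cp X, stoneCechExtendReal f z.1 = stoneCechExtendReal f w.1 := fun f => by
      have := congrArg (fun g => g.1 ⟨⟨{f}, isCompact_singleton⟩, ⟨f, rfl⟩⟩) hzw
      change realcompactExtend f ⟨z.1, z.2.1⟩ = realcompactExtend f ⟨w.1, w.2.1⟩ at this
      rw [← coe_realcompactExtend f ⟨z.1, z.2.1⟩, this, coe_realcompactExtend]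
    -- A Urysohn function on `βX`, restricted to `X`, separates `z` from `w`.
    by_contra hne
    obtain ⟨g, hg0, hg1, -⟩ := exists_continuous_zero_one_of_isClosed
      (isClosed_singleton (x := z.1)) (isClosed_singleton (x := w.1)) (by simpa using hne)
    have hg : ∀ y, stoneCechExtendReal ⟨g ∘ stoneCechUnit, g.2.comp continuous_stoneCechUnit⟩ y
        = (g y : OnePoint ℝ) := fun y =>
      stoneCechExtendReal_eq_coe (S := univ) (fun _ => mem_univ _) _
        (g.2.comp continuous_subtype_val) (fun _ => rfl) ⟨y, mem_univ y⟩
    have h01 := hf ⟨g ∘ stoneCechUnit, g.2.comp continuous_stoneCechUnit⟩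
    rw [hg, hg, hg0 rfl, hg1 rfl] at h01
    simpa using OnePoint.coe_injective h01
  refine ⟨e, .of_continuous_injective_isClosedMap he hinj (IsProperMap.isClosedMap ?_)⟩
  refine isProperMap_iff_ultrafilter.2 ⟨he, fun U g hU => ?_⟩
  -- The ultrafilter has a limit `z` in `βX`. Finiteness of `g` puts `z` in `υX`, and continuity of
  -- `g` makes `δ_z` `k`-continuous.
  obtain ⟨z, -, hz⟩ := isCompact_univ.ultrafilter_le_nhds (U.map Subtype.val) (by simp)
  have hUz : Tendsto Subtype.val (U : Filter (kContinuousPoints X)) (𝓝 z) := hz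
  have hval : ∀ p, stoneCechExtendReal p.2.1 z = (g.1 p : OnePoint ℝ) := fun p => by
    refine tendsto_nhds_unique
      (((continuous_stoneCechExtendReal p.2.1).tendsto z).comp hUz) ?_
    refine ((OnePoint.continuous_coe.tendsto _).comp
      (((continuous_eval_Cp p).tendsto g).comp hU)).congr fun w => ?_
    exact coe_realcompactExtend p.2.1 ⟨w.1, w.2.1⟩
  have hzr : z ∈ realcompactification X := fun f => by
    rw [hval ⟨⟨{f}, isCompact_singleton⟩, ⟨f, rfl⟩⟩]
    exact OnePoint.coe_ne_infty _
  have hdirac : ∀ p, diracAt ⟨z, hzr⟩ p.2.1 = g.1 p := fun p => realcompactExtend_eq (hval p)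
  have hzk : z ∈ kContinuousPoints X := by
    refine ⟨hzr, fun K hK => continuousOn_iff_continuous_domRestrict.2 ?_⟩
    exact (g.2.comp (continuous_sigmaMk (i := (⟨K, hK⟩ : {K : Set (Cp X) // IsCompact K})))).congr
      fun f => (hdirac ⟨⟨K, hK⟩, f⟩).symm
  exact ⟨⟨z, hzk⟩, Subtype.ext (funext hdirac), tendsto_subtype_rng.2 hUz⟩

/-- `δ_z` commutes with `arctan`, which maps any compact set to a uniformly bounded compact one. -/
theorem kContinuous_diracAt_of_uniformlyBounded {z : realcompactification X}
    (h : ∀ A : Set (Cp X), IsCompact A → UniformlyBounded A →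
      KContinuous (fun f : A => diracAt z f.1)) : KContinuous (diracAt z) := by
  intro K hK
  let G : Cp X → Cp X := fun f => ⟨Real.arctan ∘ f.1, Real.continuous_arctan.comp f.2⟩
  have hG : Continuous G :=
    continuous_Cp_iff.2 fun x => Real.continuous_arctan.comp (continuous_eval_Cp x)
  have hA : IsCompact (G '' K) := hK.image hG
  have hb : UniformlyBounded (G '' K) := by
    refine ⟨Real.pi / 2, by positivity, ?_⟩
    rintro _ ⟨f, -, rfl⟩ x
    exact abs_le.2 ⟨(Real.neg_pi_div_two_lt_arctan _).le, (Real.arctan_lt_pi_div_two _).le⟩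
  have : CompactSpace (G '' K) := isCompact_iff_compactSpace.1 hA
  have hcont : ContinuousOn (diracAt z) (G '' K) := continuousOn_iff_continuous_domRestrict.2
    (continuousOn_univ.1 (h _ hA hb univ isCompact_univ))
  have harctan : ContinuousOn (fun f => Real.arctan (diracAt z f)) K :=
    (hcont.comp hG.continuousOn (mapsTo_image G K)).congr fun f _ =>
      (realcompactExtend_comp Real.arctan Real.continuous_arctan f z).symm
  intro f hf
  -- `δ_z f` is finite, so its `arctan` lies strictly between `±π/2`, where `tan` is continuous.
  have htan := ContinuousAt.comp_continuousWithinAt (f := fun f => Real.arctan (diracAt z f))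
    (Real.continuousAt_tan.2 (Real.cos_arctan_pos (diracAt z f)).ne') (harctan f hf)
  simpa only [Function.comp_def, Real.tan_arctan] using htan

end

theorem propositionp {X : Type u} [TopologicalSpace X] [T35Space X] (z : StoneCech X) :
    List.TFAE [
      z ∈ kappaCompletion X,
      ∀ (K : Type u) [TopologicalSpace K] [CompactSpace K] [T2Space K] (φ : X → Cp K),
        Continuous φ →
          ∃ ψ : addPoint z → Cp K, Continuous ψ ∧ ∀ x : X, ψ (toAddPoint z x) = φ x,
      ∃ hz : z ∈ realcompactification X, KContinuous (diracAt ⟨z, hz⟩),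
      ∃ hz : z ∈ realcompactification X,
        KContinuous (fun f : CpBounded X => diracAt ⟨z, hz⟩ f.1),
      ∃ hz : z ∈ realcompactification X, ∀ A : Set (Cp X), IsCompact A → UniformlyBounded A →
        KContinuous (fun f : A => diracAt ⟨z, hz⟩ f.1)] := by
  tfae_have 1 → 3 := fun h =>
    h _ ⟨range_subset_iff.2 stoneCechUnit_mem_kContinuousPoints, isKappaSpace_kContinuousPoints⟩
  tfae_have 3 → 1 := fun ⟨hz, hk⟩ => mem_kappaCompletion_of_kContinuous hz hk
  tfae_have 3 → 2 := fun ⟨hz, hk⟩ K _ _ _ φ hφ =>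
    exists_continuous_extension_addPoint hz hk φ hφ
  tfae_have 2 → 3 := exists_kContinuous_of_extension
  tfae_have 3 → 4 := fun ⟨hz, hk⟩ => ⟨hz, hk.comp continuous_subtype_val⟩
  tfae_have 4 → 5 := fun ⟨hz, hk⟩ => ⟨hz, fun A _ ⟨C, _, hC⟩ =>
    hk.comp (g := fun f : A => (⟨f.1, C, hC f.1 f.2⟩ : CpBounded X))
      (continuous_subtype_val.subtype_mk _)⟩
  tfae_have 5 → 3 := fun ⟨hz, h⟩ => ⟨hz, kContinuous_diracAt_of_uniformlyBounded h⟩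
  tfae_finish
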